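/- Let $C$ be a field of characteristic zero, and let $S_x$, $S_k$ denote the shifts $x\mapsto x+1$ and $k\mapsto k+1$ on $C(x,y,k)$, extended to some extension field $E$ of $C(x,y,k)$. In $E$, a term $\alpha^x$ (with $\alpha\in C[y]\setminus\{0\}$) is understood as a nonzero element $e$ with $S_x(e)=\alpha e$, $S_k(e)=e$; a term $\beta^k$ as a nonzero element $e$ with $S_x(e)=e$, $S_k(e)=\beta e$; and a term $\Gamma(z)$, where $z=sx+tk+w$ with $s,t\in\mathbb Z$, $w\in C[y]$, as a nonzero element on which $S_x$ and $S_k$ act as $\Gamma(z)\mapsto\Gamma(z+s)$ and $\Gamma(z)\mapsto\Gamma(z+t)$, according to the rule $\Gamma(z+1)=z\Gamma(z)$. An element $H\in E$ is called a proper hypergeometric term if it can be written as $$H=p\,\alpha^x\beta^k\prod_{m=1}^M\frac{\Gamma(A_m)\,\Gamma(B_m)}{\Gamma(U_m)\,\Gamma(V_m)},\qquad \begin{aligned}A_m&=a_mx+a_m'k+a_m'',& B_m&=b_mx-b_m'k+b_m'',\\ U_m&=u_mx+u_m'k+u_m'',& V_m&=v_mx-v_m'k+v_m'',\end{aligned}$$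 with $p\in C[x,y,k]\setminus\{0\}$, $\alpha,\beta\in C[y]\setminus\{0\}$, $M\in\mathbb N$, $a_m,a_m',b_m,b_m',u_m,u_m',v_m,v_m'\in\mathbb N=\{0,1,2,\dots\}$ and $a_m'',b_m'',u_m'',v_m''\in C[y]$. Let $H$ be a proper hypergeometric term, written in this form, and assume that $H$ cannot be split as $H=fH_0$ with $f\in C(x,y,k)$ and a proper hypergeometric term $H_0$ satisfying $S_k(H_0)/H_0=1$. Put $\vartheta_x=\deg_x p$, $\vartheta_y=\deg_y p$, $\vartheta_k=\deg_k p$ and \begin{align*} \mu&=\max\Big\{\sum_{m=1}^M(a_m+b_m),\ \sum_{m=1}^M(u_m+v_m)\Big\},\\ \nu&=\max\Big\{\sum_{m=1}^M(a_m'+v_m'),\ \sum_{m=1}^M(u_m'+b_m')\Big\},\\ \xi&=\max\Big\{\deg_y\alpha+\sum_{m=1}^M(a_m\deg_yA_m+b_m\deg_yB_m),\ \sum_{m=1}^M(u_m\deg_yU_m+v_m\deg_yV_m)\Big\},\\ \eta&=\max\Big\{\deg_y\beta+\sum_{m=1}^M(a_m'\deg_yA_m+v_m'\deg_yV_m),\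 \sum_{m=1}^M(u_m'\deg_yU_m+b_m'\deg_yB_m)\Big\}, \end{align*} where $\deg_y 0$ is read as $0$. Let $r,d,h\in\mathbb N$ be such that $d+\vartheta_x+r\mu-\nu\ge0$, $h+\vartheta_y+r\xi-\eta\ge0$, $\vartheta_k+r\mu-\nu\ge0$ and \begin{align*} (r+1)(d+1)(h+1)&-(d+1+\vartheta_x+r\mu)(\vartheta_k+r\mu+1)\,\eta\\ &-(d+2+\vartheta_x+\vartheta_k+2r\mu-\nu)(h+1+\vartheta_y+r\xi-\eta)\,\nu>0. \end{align*} Then $H$ has a telescoper of order at most $r$, degree at most $d$ and height at most $h$. That is, there are polynomials $c_0,\dots,c_r\in C[x,y]$, not all zero, with $\deg_x c_i\le d$ and $\deg_y c_i\le h$ for all $i$, and a rational function $g\in C(x,y,k)$, such that $$c_0H+c_1S_x(H)+\cdots+c_rS_x^r(H)=S_k(gH)-gH.$$ -/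

import Mathlib

open scoped Polynomial

noncomputable section

namespace Telescoping

/-- The polynomial ring `C[x, y]`, with `x = X 0` and `y = X 1`. -/
abbrev PolyXY (C : Type*) [Field C] := MvPolynomial (Fin 2) C

/-- The polynomial ring `C[x, y, k]`, with `x = X 0`, `y = X 1` and `k = X 2`. -/
abbrev PolyXYK (C : Type*) [Field C] := MvPolynomial (Fin 3) C

/-- The field of rational functions `C(x, y, k)`. -/
abbrev RatXYK (C : Type*) [Field C] := FractionRing (PolyXYK C)

/-- The automorphism of `C[x, y, k]` that maps the variable number `i` to itself plus one and
fixes the other two variables and the field `C`. -/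
def polyShift (C : Type*) [Field C] (i : Fin 3) : PolyXYK C ≃ₐ[C] PolyXYK C :=
  AlgEquiv.ofAlgHom
    (MvPolynomial.aeval fun j => if j = i then MvPolynomial.X j + 1 else MvPolynomial.X j)
    (MvPolynomial.aeval fun j => if j = i then MvPolynomial.X j - 1 else MvPolynomial.X j)
    (by ext j : 1; by_cases h : j = i <;> simp [h])
    (by ext j : 1; by_cases h : j = i <;> simp [h])

/-- The shift of the variable number `i`, as an automorphism of `C(x, y, k)`. -/
def ratShift (C : Type*) [Field C] (i : Fin 3) : RatXYK C ≃+* RatXYK C :=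
  IsFractionRing.ringEquivOfRingEquiv (polyShift C i).toRingEquiv

/-- The inclusion of `C[x, y]` into `C(x, y, k)`. -/
def ofXY (C : Type*) [Field C] : PolyXY C →+* RatXYK C :=
  (algebraMap (PolyXYK C) (RatXYK C)).comp
    (MvPolynomial.rename (R := C) (Fin.castSucc : Fin 2 → Fin 3)).toRingHom

/-- The inclusion of `C[y]` into `C[x, y, k]`. -/
def ofY (C : Type*) [Field C] : C[X] →ₐ[C] PolyXYK C :=
  Polynomial.aeval (MvPolynomial.X 1)

/-- Extensions of the two shifts `S_x` and `S_k` from `C(x, y, k)` to an extension field `E`.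
Neither bijectivity nor commutativity of the extended shifts is required. -/
structure ShiftExtension (C : Type*) [Field C] (E : Type*) [Field E] [Algebra (RatXYK C) E] where
  /-- the shift of `x` -/
  Sx : E →+* E
  /-- the shift of `k` -/
  Sk : E →+* E
  Sx_algebraMap : ∀ f : RatXYK C,
    Sx (algebraMap (RatXYK C) E f) = algebraMap (RatXYK C) E (ratShift C 0 f)
  Sk_algebraMap : ∀ f : RatXYK C,
    Sk (algebraMap (RatXYK C) E f) = algebraMap (RatXYK C) E (ratShift C 2 f)

/-- The polynomial `s x + t k + w` for integers `s`, `t` and `w ∈ C[y]`. -/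
def linForm {C : Type*} [Field C] (s t : ℤ) (w : C[X]) : PolyXYK C :=
  (s : PolyXYK C) * MvPolynomial.X 0 + (t : PolyXYK C) * MvPolynomial.X 2 + ofY C w

/-- The quotient `Γ(z + n) / Γ(z)`: it is `z (z + 1) ⋯ (z + n - 1)` for `n ≥ 0`, and
`1 / ((z - 1) (z - 2) ⋯ (z + n))` for `n < 0`. -/
def gammaQuotient {K : Type*} [Field K] (z : K) : ℤ → K
  | Int.ofNat n => ∏ i ∈ Finset.range n, (z + i)
  | Int.negSucc n => (∏ i ∈ Finset.range (n + 1), (z - (i + 1)))⁻¹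

section Terms

variable {C : Type*} [Field C] {E : Type*} [Field E] [Algebra (RatXYK C) E]

/-- `H` is a hypergeometric term with respect to `x` and `k`: it is nonzero, and its two shift
quotients lie in `C(x, y, k)`. -/
def IsHypergeometric (S : ShiftExtension C E) (H : E) : Prop :=
  H ≠ 0 ∧ (∃ q : RatXYK C, S.Sx H / H = algebraMap (RatXYK C) E q) ∧
    ∃ q : RatXYK C, S.Sk H / H = algebraMap (RatXYK C) E q

/-- `g` is a term `α ^ x`. -/
def IsPowX (S : ShiftExtension C E) (α : C[X]) (g : E) : Prop :=
  g ≠ 0 ∧ S.Sx g = algebraMap (RatXYK C) E (algebraMap (PolyXYK C) (RatXYK C) (ofY C α)) * g ∧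
    S.Sk g = g

/-- `g` is a term `β ^ k`. -/
def IsPowK (S : ShiftExtension C E) (β : C[X]) (g : E) : Prop :=
  g ≠ 0 ∧ S.Sx g = g ∧
    S.Sk g = algebraMap (RatXYK C) E (algebraMap (PolyXYK C) (RatXYK C) (ofY C β)) * g

/-- `g` is a term `Γ(s x + t k + w)`: a nonzero element on which the shifts `S_x` and `S_k` act
as `Γ(z) ↦ Γ(z + s)` and `Γ(z) ↦ Γ(z + t)`, where `z = s x + t k + w`. -/
def IsGamma (S : ShiftExtension C E) (s t : ℤ) (w : C[X]) (g : E) : Prop :=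
  g ≠ 0 ∧
    S.Sx g = algebraMap (RatXYK C) E
      (gammaQuotient (algebraMap (PolyXYK C) (RatXYK C) (linForm s t w)) s) * g ∧
    S.Sk g = algebraMap (RatXYK C) E
      (gammaQuotient (algebraMap (PolyXYK C) (RatXYK C) (linForm s t w)) t) * g

end Terms

/-- The data of an expression
`p α^x β^k ∏ₘ Γ(aₘ x + aₘ' k + aₘ'') Γ(bₘ x - bₘ' k + bₘ'') /
  (Γ(uₘ x + uₘ' k + uₘ'') Γ(vₘ x - vₘ' k + vₘ''))`.
In the names of the fields the primes are replaced by the numbers 1 and 2. -/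
structure ProperForm (C : Type*) [Field C] where
  p : PolyXYK C
  p_ne_zero : p ≠ 0
  α : C[X]
  α_ne_zero : α ≠ 0
  β : C[X]
  β_ne_zero : β ≠ 0
  M : ℕ
  (a a1 b b1 u u1 v v1 : Fin M → ℕ)
  (a2 b2 u2 v2 : Fin M → C[X])

namespace ProperForm

variable {C : Type*} [Field C] (D : ProperForm C)

/-- `Aₘ = aₘ x + aₘ' k + aₘ''` -/
def A (m : Fin D.M) : PolyXYK C := linForm (D.a m) (D.a1 m) (D.a2 m)

/-- `Bₘ = bₘ x - bₘ' k + bₘ''` -/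
def B (m : Fin D.M) : PolyXYK C := linForm (D.b m) (-(D.b1 m : ℤ)) (D.b2 m)

/-- `Uₘ = uₘ x + uₘ' k + uₘ''` -/
def U (m : Fin D.M) : PolyXYK C := linForm (D.u m) (D.u1 m) (D.u2 m)

/-- `Vₘ = vₘ x - vₘ' k + vₘ''` -/
def V (m : Fin D.M) : PolyXYK C := linForm (D.v m) (-(D.v1 m : ℤ)) (D.v2 m)

/-- `ϑ_x = deg_x p` -/
def thetaX : ℕ := D.p.degreeOf 0

/-- `ϑ_y = deg_y p` -/
def thetaY : ℕ := D.p.degreeOf 1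

/-- `ϑ_k = deg_k p` -/
def thetaK : ℕ := D.p.degreeOf 2

/-- `μ = max {∑ (aₘ + bₘ), ∑ (uₘ + vₘ)}` -/
def mu : ℕ := max (∑ m, (D.a m + D.b m)) (∑ m, (D.u m + D.v m))

/-- `ν = max {∑ (aₘ' + vₘ'), ∑ (uₘ' + bₘ')}` -/
def nu : ℕ := max (∑ m, (D.a1 m + D.v1 m)) (∑ m, (D.u1 m + D.b1 m))

/-- `ξ = max {deg_y α + ∑ (aₘ deg_y Aₘ + bₘ deg_y Bₘ), ∑ (uₘ deg_y Uₘ + vₘ deg_y Vₘ)}` -/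
def xi : ℕ :=
  max (D.α.natDegree + ∑ m, (D.a m * (D.A m).degreeOf 1 + D.b m * (D.B m).degreeOf 1))
    (∑ m, (D.u m * (D.U m).degreeOf 1 + D.v m * (D.V m).degreeOf 1))

/-- `η = max {deg_y β + ∑ (aₘ' deg_y Aₘ + vₘ' deg_y Vₘ), ∑ (uₘ' deg_y Uₘ + bₘ' deg_y Bₘ)}` -/
def eta : ℕ :=
  max (D.β.natDegree + ∑ m, (D.a1 m * (D.A m).degreeOf 1 + D.v1 m * (D.V m).degreeOf 1))
    (∑ m, (D.u1 m * (D.U m).degreeOf 1 + D.b1 m * (D.B m).degreeOf 1))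

/-- The element `H` of `E` is given by the expression `D`. -/
def IsFormOf {E : Type*} [Field E] [Algebra (RatXYK C) E] (S : ShiftExtension C E) (H : E) :
    Prop :=
  ∃ (ex ek : E) (gA gB gU gV : Fin D.M → E),
    IsPowX S D.α ex ∧ IsPowK S D.β ek ∧
    (∀ m, IsGamma S (D.a m) (D.a1 m) (D.a2 m) (gA m)) ∧
    (∀ m, IsGamma S (D.b m) (-(D.b1 m : ℤ)) (D.b2 m) (gB m)) ∧
    (∀ m, IsGamma S (D.u m) (D.u1 m) (D.u2 m) (gU m)) ∧
    (∀ m, IsGamma S (D.v m) (-(D.v1 m : ℤ)) (D.v2 m) (gV m)) ∧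
    H = algebraMap (RatXYK C) E (algebraMap (PolyXYK C) (RatXYK C) D.p) * ex * ek *
      ∏ m, (gA m * gB m) / (gU m * gV m)

end ProperForm

section Telescopers

variable {C : Type*} [Field C] {E : Type*} [Field E] [Algebra (RatXYK C) E]

/-- `H` is a proper hypergeometric term. -/
def IsProperHypergeometric (S : ShiftExtension C E) (H : E) : Prop :=
  IsHypergeometric S H ∧ ∃ D : ProperForm C, D.IsFormOf S H

/-- `H` can be split as `H = f H₀` with `f ∈ C(x, y, k)` and a proper hypergeometric term `H₀`
such that `S_k(H₀) / H₀ = 1`. -/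
def IsRationalUpToConstant (S : ShiftExtension C E) (H : E) : Prop :=
  ∃ (f : RatXYK C) (H₀ : E), IsProperHypergeometric S H₀ ∧ S.Sk H₀ / H₀ = 1 ∧
    H = algebraMap (RatXYK C) E f * H₀

/-- Operators `c_0 + c_1 S_x + ⋯ + c_r S_x^r` with coefficients in `C[x, y]` written on the left.
The product of two operators is not needed below. -/
abbrev Operator (C : Type*) [Field C] := SkewPolynomial (PolyXY C)

namespace Operator

/-- The order of an operator, which is its degree in `S_x`. -/
def order (L : Operator C) : ℕ := (SkewPolynomial.support L).sup id

/-- The degree of an operator, which is its degree in `x`. -/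
def degree (L : Operator C) : ℕ :=
  (SkewPolynomial.support L).sup fun i => (SkewPolynomial.coeff L i).degreeOf 0

/-- The height of an operator, which is its degree in `y`. -/
def height (L : Operator C) : ℕ :=
  (SkewPolynomial.support L).sup fun i => (SkewPolynomial.coeff L i).degreeOf 1

/-- The action `L(H) = ∑ c_i S_x^i(H)`. -/
def apply (S : ShiftExtension C E) (L : Operator C) (H : E) : E :=
  ∑ i ∈ SkewPolynomial.support L,
    algebraMap (RatXYK C) E (ofXY C (SkewPolynomial.coeff L i)) * S.Sx^[i] H

end Operator

/-- `L` is a telescoper for `H`: it is nonzero, and there is a certificate `g ∈ C(x, y, k)` with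
`L(H) = S_k(g H) - g H`. -/
def IsTelescoper (S : ShiftExtension C E) (H : E) (L : Operator C) : Prop :=
  L ≠ 0 ∧ ∃ g : RatXYK C, Operator.apply S L H =
    S.Sk (algebraMap (RatXYK C) E g * H) - algebraMap (RatXYK C) E g * H

end Telescopers

end Telescoping

end

/-!
The shifts `S_x^i(H)` with `i ≤ r` are polynomial multiples `Pᵢ H₁` of one element `H₁`, obtained
from `H` by dropping `p` and replacing each factor `1 / Γ(z)` by `1 / Γ(z + s r)`, where `s` is the
coefficient of `x` in `z`. Rising factorials in denominators do not vanish, because the Gamma terms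
and their shifts are nonzero elements of `E`. Write `S_k(H₁) / H₁ = Q / S_k(R)` with polynomials `Q`
and `R`. The ansatz `g H = Y R H₁` turns `∑ cᵢ S_x^i(H) = S_k(g H) - g H` into
`∑ cᵢ Pᵢ = Q S_k(Y) - R Y`, a homogeneous linear system over `C` for the coefficients of the
polynomials `cᵢ` and `Y`, and the inequality says that it has more unknowns than equations. If all
`cᵢ` vanished in a nonzero solution, then `Y R H₁` would be a proper hypergeometric term fixed by
`S_k`, and `H` would be a rational multiple of it.
-/

open scoped Polynomial

noncomputable section

namespace Telescoping

section DegreeBox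

variable {σ τ : Type*} (R : Type*) [CommSemiring R]

/-- The polynomials whose degree in the variable number `i` is at most `n i`, for all `i`. These
spaces carry the unknowns and the equations of the linear system behind a telescoper. -/
def degreeBox (n : σ → ℕ) : Submodule R (MvPolynomial σ R) :=
  MvPolynomial.restrictSupport R {s | ∀ i, s i ≤ n i}

variable {R}

theorem mem_degreeBox {n : σ → ℕ} {p : MvPolynomial σ R} :
    p ∈ degreeBox R n ↔ ∀ i, p.degreeOf i ≤ n i := by
  simp only [degreeBox, MvPolynomial.mem_restrictSupport_iff, MvPolynomial.degreeOf_le_iff]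
  exact ⟨fun h i m hm => h hm i, fun h m hm i => h i m hm⟩

theorem degreeBox_mono {m n : σ → ℕ} (h : m ≤ n) : degreeBox R m ≤ degreeBox R n :=
  MvPolynomial.restrictSupport_mono R fun _ hs i => (hs i).trans (h i)

theorem mul_mem_degreeBox {m n : σ → ℕ} {p q : MvPolynomial σ R} (hp : p ∈ degreeBox R m)
    (hq : q ∈ degreeBox R n) : p * q ∈ degreeBox R (m + n) :=
  mem_degreeBox.2 fun i => (MvPolynomial.degreeOf_mul_le i p q).trans <|
    add_le_add (mem_degreeBox.1 hp i) (mem_degreeBox.1 hq i)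

theorem C_mem_degreeBox (a : R) (n : σ → ℕ) : MvPolynomial.C a ∈ degreeBox R n :=
  mem_degreeBox.2 fun i => by simp only [MvPolynomial.degreeOf_C, zero_le]

theorem one_mem_degreeBox (n : σ → ℕ) : (1 : MvPolynomial σ R) ∈ degreeBox R n := by
  simpa only [map_one] using C_mem_degreeBox (1 : R) n

theorem prod_mem_degreeBox {ι : Type*} {s : Finset ι} {n : ι → σ → ℕ}
    {f : ι → MvPolynomial σ R} (h : ∀ j ∈ s, f j ∈ degreeBox R (n j)) :
    ∏ j ∈ s, f j ∈ degreeBox R (∑ j ∈ s, n j) := by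
  refine mem_degreeBox.2 fun i => (MvPolynomial.degreeOf_prod_le i s f).trans ?_
  rw [Finset.sum_apply]
  exact Finset.sum_le_sum fun j hj => mem_degreeBox.1 (h j hj) i

theorem pow_mem_degreeBox {n : σ → ℕ} {p : MvPolynomial σ R} (hp : p ∈ degreeBox R n) (k : ℕ) :
    p ^ k ∈ degreeBox R (k • n) := by
  simpa only [Finset.prod_const, Finset.sum_const, Finset.card_range] using
    prod_mem_degreeBox (s := Finset.range k) fun _ _ => hp

theorem X_mem_degreeBox [DecidableEq σ] (i : σ) :
    MvPolynomial.X i ∈ degreeBox R (Pi.single i 1) :=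
  (MvPolynomial.mem_restrictSupport_iff R).2 fun s hs j => by
    rw [Finset.mem_singleton.1 (MvPolynomial.support_monomial_subset hs),
      Finsupp.single_eq_pi_single]

theorem algHom_mem_degreeBox [Fintype σ] {φ : MvPolynomial σ R →ₐ[R] MvPolynomial τ R}
    {w : σ → τ → ℕ} (hφ : ∀ j, φ (MvPolynomial.X j) ∈ degreeBox R (w j)) {n : σ → ℕ}
    {p : MvPolynomial σ R} (hp : p ∈ degreeBox R n) : φ p ∈ degreeBox R (∑ j, n j • w j) := by
  rw [p.as_sum, map_sum]
  refine Submodule.sum_mem _ fun s hs => ?_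
  rw [MvPolynomial.monomial_eq, map_mul, Finsupp.prod_fintype _ _ (fun _ => pow_zero _), map_prod,
    ← MvPolynomial.algebraMap_eq, φ.commutes, MvPolynomial.algebraMap_eq,
    MvPolynomial.C_mul']
  refine Submodule.smul_mem _ _ (degreeBox_mono (m := ∑ j, s j • w j) ?_ ?_)
  · exact Finset.sum_le_sum fun j _ => nsmul_le_nsmul_left (zero_le) (hp hs j)
  · refine prod_mem_degreeBox fun j _ => ?_
    rw [map_pow]
    exact pow_mem_degreeBox (hφ j) (s j)

variable [Fintype σ]

/-- Exponent vectors below `n`, read as tuples of elements of `Fin (n i + 1)`. They index the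
monomials in `degreeBox R n`. -/
def boxEquiv (n : σ → ℕ) : {s : σ →₀ ℕ | ∀ i, s i ≤ n i} ≃ ∀ i, Fin (n i + 1) where
  toFun s i := ⟨s.1 i, Nat.lt_succ_of_le (s.2 i)⟩
  invFun t := ⟨Finsupp.equivFunOnFinite.symm fun i => t i, fun i => Nat.le_of_lt_succ (t i).2⟩
  left_inv s := by ext; rfl
  right_inv t := by ext; rfl

/-- The monomial basis of `degreeBox R n`. -/
def degreeBoxBasis (n : σ → ℕ) : Module.Basis (∀ i, Fin (n i + 1)) R (degreeBox R n) :=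
  (MvPolynomial.basisRestrictSupport R _).reindex (boxEquiv n)

theorem finrank_degreeBox [StrongRankCondition R] (n : σ → ℕ) :
    Module.finrank R (degreeBox R n) = ∏ i, (n i + 1) := by
  classical
  rw [Module.finrank_eq_card_basis (degreeBoxBasis n), Fintype.card_pi]
  simp only [Fintype.card_fin]

end DegreeBox

theorem finite_degreeBox {σ R : Type*} [Finite σ] [CommSemiring R] (n : σ → ℕ) :
    Module.Finite R (degreeBox R n) :=
  have := Fintype.ofFinite σ
  .of_basis (degreeBoxBasis n)

theorem add_intCast_mem_degreeBox {σ R : Type*} [CommRing R] {n : σ → ℕ} {z : MvPolynomial σ R}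
    (hz : z ∈ degreeBox R n) (m : ℤ) : z + m ∈ degreeBox R n := by
  simpa only [map_intCast] using add_mem hz (C_mem_degreeBox (m : R) n)

section Polynomials

variable {C : Type*} [Field C]

theorem polyShift_X (i j : Fin 3) : polyShift C i (MvPolynomial.X j) =
    if j = i then MvPolynomial.X j + 1 else MvPolynomial.X j := by
  simp only [polyShift, AlgEquiv.ofAlgHom_apply, MvPolynomial.aeval_X]

theorem polyShift_mem_degreeBox (i : Fin 3) {n : Fin 3 → ℕ} {p : PolyXYK C}
    (hp : p ∈ degreeBox C n) : polyShift C i p ∈ degreeBox C n := by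
  have hX (j : Fin 3) : (polyShift C i : PolyXYK C →ₐ[C] PolyXYK C) (MvPolynomial.X j) ∈
      degreeBox C (Pi.single j 1) := by
    rw [AlgEquiv.coe_toAlgHom, polyShift_X]
    split_ifs
    · exact Submodule.add_mem _ (X_mem_degreeBox j) (one_mem_degreeBox _)
    · exact X_mem_degreeBox j
  have hn : ∑ j, n j • Pi.single j 1 = n := by
    ext j
    simp [Finset.sum_apply, Pi.single_apply]
  simpa only [hn, AlgEquiv.coe_toAlgHom] using algHom_mem_degreeBox hX hp

/-- The inclusion of `C[x, y]` into `C[x, y, k]`, through which `ofXY` factors. -/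
abbrev polyOfXY (C : Type*) [Field C] : PolyXY C →ₐ[C] PolyXYK C :=
  MvPolynomial.rename Fin.castSucc

theorem polyOfXY_mem_degreeBox {n : Fin 2 → ℕ} {c : PolyXY C} (hc : c ∈ degreeBox C n) :
    polyOfXY C c ∈ degreeBox C ![n 0, n 1, 0] := by
  have hX (j : Fin 2) : polyOfXY C (MvPolynomial.X j) ∈
      degreeBox C (Pi.single (Fin.castSucc j) 1) := by
    rw [MvPolynomial.rename_X]
    exact X_mem_degreeBox _
  refine degreeBox_mono (fun j => ?_) (algHom_mem_degreeBox hX hc)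
  fin_cases j <;> simp [Fin.sum_univ_two, Pi.single_apply]

theorem ofY_mem_degreeBox (w : C[X]) : ofY C w ∈ degreeBox C ![0, w.natDegree, 0] := by
  rw [ofY, Polynomial.aeval_eq_sum_range]
  refine Submodule.sum_mem _ fun i hi => Submodule.smul_mem _ _ ?_
  refine degreeBox_mono (fun j => ?_) (pow_mem_degreeBox (X_mem_degreeBox 1) i)
  have hi' := Finset.mem_range_succ_iff.1 hi
  fin_cases j <;> simp [hi']

theorem polyShift_ofY {i : Fin 3} (hi : i ≠ 1) (w : C[X]) :
    polyShift C i (ofY C w) = ofY C w := by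
  rw [ofY, ← Polynomial.aeval_algHom_apply, polyShift_X, if_neg hi.symm]

theorem polyShift_zero_linForm (s t : ℤ) (w : C[X]) :
    polyShift C 0 (linForm s t w) = linForm s t w + s := by
  simp only [linForm, map_add, map_mul, map_intCast, polyShift_X, polyShift_ofY zero_ne_one,
    if_true, if_neg (show (2 : Fin 3) ≠ 0 by decide)]
  ring

theorem polyShift_two_linForm (s t : ℤ) (w : C[X]) :
    polyShift C 2 (linForm s t w) = linForm s t w + t := by
  simp only [linForm, map_add, map_mul, map_intCast, polyShift_X,
    polyShift_ofY (show (2 : Fin 3) ≠ 1 by decide), if_true,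
    if_neg (show (0 : Fin 3) ≠ 2 by decide)]
  ring

theorem linForm_add_natCast (s t : ℤ) (w : C[X]) (n : ℕ) :
    linForm s t (w + (n : C[X])) = linForm s t w + (n : PolyXYK C) := by
  simp only [linForm, map_add, map_natCast, add_assoc]

/-- The degree bounds `(1, deg_y z, 1)` of a form `z = s x + t k + w`. -/
def linDegree (z : PolyXYK C) : Fin 3 → ℕ := ![1, z.degreeOf 1, 1]

theorem linForm_mem_degreeBox (s t : ℤ) (w : C[X]) :
    linForm s t w ∈ degreeBox C (linDegree (linForm s t w)) := by
  have hmul (a : ℤ) (i : Fin 3) :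
      (a : PolyXYK C) * MvPolynomial.X i ∈ degreeBox C (Pi.single i 1) := by
    rw [← zsmul_eq_mul]
    exact zsmul_mem (X_mem_degreeBox i) a
  have hlin : linForm s t w ∈ degreeBox C ![1, w.natDegree, 1] := by
    refine Submodule.add_mem _ (Submodule.add_mem _ (degreeBox_mono (fun j => ?_) (hmul s 0))
      (degreeBox_mono (fun j => ?_) (hmul t 2)))
      (degreeBox_mono (fun j => ?_) (ofY_mem_degreeBox w)) <;> fin_cases j <;> simp
  have hdeg := mem_degreeBox.1 hlin
  refine mem_degreeBox.2 fun j => ?_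
  fin_cases j
  exacts [hdeg 0, le_rfl, hdeg 2]

end Polynomials

section LinearSystem

variable {C : Type*} [Field C] {ι : Type*} [Fintype ι]

/-- The linear map `(c, Y) ↦ ∑ cᵢ Pᵢ - (Q S_k(Y) - R Y)`. Its kernel consists of the telescopers
`∑ cᵢ S_x^i`, each with the numerator `Y` of a certificate. -/
def telescopingMap (P : ι → PolyXYK C) (Q R : PolyXYK C) :
    (ι → PolyXY C) × PolyXYK C →ₗ[C] PolyXYK C where
  toFun z := ∑ i, polyOfXY C (z.1 i) * P i - (Q * polyShift C 2 z.2 - R * z.2)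
  map_add' z z' := by
    simp only [Prod.fst_add, Prod.snd_add, Pi.add_apply, map_add, add_mul, mul_add,
      Finset.sum_add_distrib]
    ring
  map_smul' a z := by
    simp only [Prod.smul_fst, Prod.smul_snd, Pi.smul_apply, map_smul, smul_mul_assoc,
      mul_smul_comm, ← Finset.smul_sum, ← smul_sub, RingHom.id_apply]

theorem telescopingMap_mem_degreeBox {P : ι → PolyXYK C} {Q R : PolyXYK C} {m : Fin 2 → ℕ}
    {e : ι → Fin 3 → ℕ} {n y : Fin 3 → ℕ} (hP : ∀ i, P i ∈ degreeBox C (e i))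
    (hQ : Q ∈ degreeBox C n) (hR : R ∈ degreeBox C n)
    (he : ∀ i, ![m 0, m 1, 0] + e i ≤ n + y) {c : ι → PolyXY C} {Y : PolyXYK C}
    (hc : ∀ i, c i ∈ degreeBox C m) (hY : Y ∈ degreeBox C y) :
    telescopingMap P Q R (c, Y) ∈ degreeBox C (n + y) :=
  Submodule.sub_mem _
    (Submodule.sum_mem _ fun i _ => degreeBox_mono (he i) <|
      mul_mem_degreeBox (polyOfXY_mem_degreeBox (hc i)) (hP i))
    (Submodule.sub_mem _ (mul_mem_degreeBox hQ (polyShift_mem_degreeBox 2 hY))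
      (mul_mem_degreeBox hR hY))

theorem exists_telescopingMap_eq_zero {P : ι → PolyXYK C} {Q R : PolyXYK C} {m : Fin 2 → ℕ}
    {e : ι → Fin 3 → ℕ} {n y : Fin 3 → ℕ} (hP : ∀ i, P i ∈ degreeBox C (e i))
    (hQ : Q ∈ degreeBox C n) (hR : R ∈ degreeBox C n)
    (he : ∀ i, ![m 0, m 1, 0] + e i ≤ n + y)
    (hcard : ∏ j, (n j + y j + 1) <
      Fintype.card ι * ∏ j, (m j + 1) + ∏ j, (y j + 1)) :
    ∃ (c : ι → PolyXY C) (Y : PolyXYK C), (c, Y) ≠ 0 ∧ (∀ i, c i ∈ degreeBox C m) ∧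
      telescopingMap P Q R (c, Y) = 0 := by
  have := finite_degreeBox (R := C) m
  have := finite_degreeBox (R := C) y
  have := finite_degreeBox (R := C) (n + y)
  let incl : (ι → degreeBox C m) × degreeBox C y →ₗ[C] (ι → PolyXY C) × PolyXYK C :=
    ((degreeBox C m).subtype.compLeft ι).prodMap (degreeBox C y).subtype
  have hincl : Function.Injective incl :=
    Function.Injective.prodMap
      (Function.Injective.comp_left (degreeBox C m).injective_subtype)
      (degreeBox C y).injective_subtype
  have hmem (z) : (telescopingMap P Q R ∘ₗ incl) z ∈ degreeBox C (n + y) :=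
    telescopingMap_mem_degreeBox hP hQ hR he (fun i => (z.1 i).2) z.2.2
  have hker : LinearMap.ker ((telescopingMap P Q R ∘ₗ incl).codRestrict _ hmem) ≠ ⊥ := by
    apply LinearMap.ker_ne_bot_of_finrank_lt
    rw [Module.finrank_prod, Module.finrank_pi_fintype]
    simpa only [finrank_degreeBox, Pi.add_apply, Finset.sum_const, Finset.card_univ,
      smul_eq_mul] using hcard
  obtain ⟨z, hz, hz0⟩ := Submodule.exists_mem_ne_zero_of_ne_bot hker
  rw [LinearMap.ker_codRestrict, LinearMap.mem_ker] at hz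
  exact ⟨_, _, (map_ne_zero_iff incl hincl).2 hz0, fun i => (z.1 i).2, hz⟩

end LinearSystem

section RisingFactorial

variable {R : Type*} [CommRing R]

/-- The rising factorial `z (z + 1) ⋯ (z + n - 1)`, which is `Γ(z + n) / Γ(z)`. -/
def risingFactorial (z : R) (n : ℕ) : R :=
  ∏ i ∈ Finset.range n, (z + i)

theorem risingFactorial_zero (z : R) : risingFactorial z 0 = 1 :=
  Finset.prod_range_zero _

theorem risingFactorial_add (z : R) (m n : ℕ) :
    risingFactorial z (m + n) = risingFactorial z m * risingFactorial (z + m) n := by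
  simp only [risingFactorial, Finset.prod_range_add, Nat.cast_add, add_assoc]

theorem risingFactorial_mul_comm (z : R) (m n : ℕ) :
    risingFactorial z m * risingFactorial (z + m) n =
      risingFactorial z n * risingFactorial (z + n) m := by
  rw [← risingFactorial_add, ← risingFactorial_add, add_comm]

theorem risingFactorial_sub_natCast (z : R) (n : ℕ) :
    risingFactorial (z - n) n = ∏ i ∈ Finset.range n, (z - (i + 1)) := by
  rw [risingFactorial, ← Finset.prod_range_reflect]
  refine Finset.prod_congr rfl fun i hi => ?_
  rw [Nat.sub_sub, Nat.cast_sub (Nat.one_add i ▸ Finset.mem_range.1 hi)]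
  push_cast
  ring

theorem map_risingFactorial {S F : Type*} [CommRing S] [FunLike F R S] [RingHomClass F R S]
    (f : F) (z : R) (n : ℕ) : f (risingFactorial z n) = risingFactorial (f z) n := by
  simp only [risingFactorial, map_prod, map_add, map_natCast]

theorem risingFactorial_mem_degreeBox {σ : Type*} {n : σ → ℕ} {z : MvPolynomial σ R}
    (hz : z ∈ degreeBox R n) (m : ℕ) : risingFactorial z m ∈ degreeBox R (m • n) := by
  rw [risingFactorial]
  simpa only [Finset.sum_const, Finset.card_range, Int.cast_natCast] using
    prod_mem_degreeBox (s := Finset.range m) fun i _ => add_intCast_mem_degreeBox hz i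

variable {K : Type*} [Field K]

theorem gammaQuotient_eq_div (z : K) (t : ℤ) :
    gammaQuotient z t = risingFactorial z t.toNat / risingFactorial (z + t) (-t).toNat := by
  cases t with
  | ofNat n =>
    simp only [gammaQuotient, Int.ofNat_eq_natCast, Int.toNat_natCast, Int.toNat_neg_natCast,
      risingFactorial_zero, div_one]
    rfl
  | negSucc n =>
    simp only [gammaQuotient, Int.toNat_negSucc, Int.neg_negSucc, Int.toNat_natCast,
      Int.cast_negSucc, ← sub_eq_add_neg, risingFactorial_sub_natCast, risingFactorial_zero,
      one_div]

theorem map_gammaQuotient {L : Type*} [Field L] (f : K →+* L) (z : K) (t : ℤ) :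
    f (gammaQuotient z t) = gammaQuotient (f z) t := by
  simp only [gammaQuotient_eq_div, map_div₀, map_risingFactorial, map_add, map_intCast]

theorem gammaQuotient_add_natCast_mul {z : K} {t : ℤ} {n : ℕ} (hz : risingFactorial z n ≠ 0)
    (ht : gammaQuotient z t ≠ 0) :
    gammaQuotient (z + n) t * risingFactorial z n =
      risingFactorial (z + t) n * gammaQuotient z t := by
  simp only [gammaQuotient_eq_div] at ht ⊢
  have hcomm := risingFactorial_mul_comm (z + t) n (-t).toNat
  have hcast : z + t + (-t).toNat = z + t.toNat := by
    rw [add_assoc]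
    exact_mod_cast congrArg (fun m : ℤ => z + m) (show t + (-t).toNat = t.toNat by omega)
  rw [hcast, add_right_comm] at hcomm
  have hden : risingFactorial (z + t) (-t).toNat ≠ 0 := (div_ne_zero_iff.1 ht).2
  have hden' : risingFactorial (z + n + t) (-t).toNat ≠ 0 := by
    rcases le_total 0 t with h | h
    · rw [Int.toNat_of_nonpos (neg_nonpos.2 h), risingFactorial_zero]
      exact one_ne_zero
    · rw [Int.toNat_of_nonpos h, Nat.cast_zero, add_zero] at hcomm
      exact right_ne_zero_of_mul (hcomm ▸ mul_ne_zero hden hz)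
  rw [div_mul_eq_mul_div, ← mul_div_assoc, div_eq_div_iff hden' hden]
  linear_combination risingFactorial (z + t) (-t).toNat * risingFactorial_mul_comm z n t.toNat
    - risingFactorial z t.toNat * hcomm

end RisingFactorial

section Terms

variable {C : Type*} [Field C] {E : Type*} [Field E] [Algebra (RatXYK C) E]

variable (E) in
/-- The inclusion of `C[x, y, k]` into `E`. -/
def ofPoly : PolyXYK C →+* E :=
  (algebraMap (RatXYK C) E).comp (algebraMap (PolyXYK C) (RatXYK C))

theorem ofPoly_injective : Function.Injective (ofPoly E : PolyXYK C →+* E) :=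
  (algebraMap (RatXYK C) E).injective.comp (IsFractionRing.injective _ _)

theorem ofPoly_ne_zero {p : PolyXYK C} (hp : p ≠ 0) : ofPoly E p ≠ 0 :=
  (map_ne_zero_iff _ ofPoly_injective).2 hp

theorem exists_algebraMap_eq_ofPoly_div (p q : PolyXYK C) :
    ∃ f : RatXYK C, algebraMap (RatXYK C) E f = ofPoly E p / ofPoly E q :=
  ⟨_, map_div₀ (algebraMap (RatXYK C) E) (algebraMap _ _ p) (algebraMap _ _ q)⟩

theorem ratShift_algebraMap (i : Fin 3) (p : PolyXYK C) :
    ratShift C i (algebraMap (PolyXYK C) (RatXYK C) p) = algebraMap _ _ (polyShift C i p) :=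
  IsFractionRing.ringEquivOfRingEquiv_algebraMap _ p

variable {S : ShiftExtension C E}

variable (S) in
theorem ShiftExtension.Sx_ofPoly (p : PolyXYK C) :
    S.Sx (ofPoly E p) = ofPoly E (polyShift C 0 p) := by
  simp only [ofPoly, RingHom.comp_apply, S.Sx_algebraMap, ratShift_algebraMap]

variable (S) in
theorem ShiftExtension.Sk_ofPoly (p : PolyXYK C) :
    S.Sk (ofPoly E p) = ofPoly E (polyShift C 2 p) := by
  simp only [ofPoly, RingHom.comp_apply, S.Sk_algebraMap, ratShift_algebraMap]

variable (S) in
theorem ShiftExtension.Sx_risingFactorial (s t : ℤ) (w : C[X]) (n : ℕ) :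
    S.Sx (risingFactorial (ofPoly E (linForm s t w)) n) =
      risingFactorial (ofPoly E (linForm s t w) + s) n := by
  rw [map_risingFactorial, S.Sx_ofPoly, polyShift_zero_linForm, map_add, map_intCast]

variable (S) in
theorem ShiftExtension.Sk_risingFactorial (s t : ℤ) (w : C[X]) (n : ℕ) :
    S.Sk (risingFactorial (ofPoly E (linForm s t w)) n) =
      risingFactorial (ofPoly E (linForm s t w) + t) n := by
  rw [map_risingFactorial, S.Sk_ofPoly, polyShift_two_linForm, map_add, map_intCast]

theorem isGamma_iff {s t : ℤ} {w : C[X]} {g : E} : IsGamma S s t w g ↔ g ≠ 0 ∧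
    S.Sx g = gammaQuotient (ofPoly E (linForm s t w)) s * g ∧
    S.Sk g = gammaQuotient (ofPoly E (linForm s t w)) t * g := by
  simp only [IsGamma, map_gammaQuotient, ofPoly, RingHom.comp_apply]

namespace IsGamma

variable {s t : ℤ} {w : C[X]} {g : E}

theorem Sx_eq (hg : IsGamma S s t w g) :
    S.Sx g = gammaQuotient (ofPoly E (linForm s t w)) s * g :=
  (isGamma_iff.1 hg).2.1

theorem Sk_eq (hg : IsGamma S s t w g) :
    S.Sk g = gammaQuotient (ofPoly E (linForm s t w)) t * g :=
  (isGamma_iff.1 hg).2.2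

theorem gammaQuotient_Sx_ne_zero (hg : IsGamma S s t w g) :
    gammaQuotient (ofPoly E (linForm s t w)) s ≠ 0 :=
  left_ne_zero_of_mul (hg.Sx_eq ▸ (map_ne_zero S.Sx).2 hg.1)

theorem gammaQuotient_Sk_ne_zero (hg : IsGamma S s t w g) :
    gammaQuotient (ofPoly E (linForm s t w)) t ≠ 0 :=
  left_ne_zero_of_mul (hg.Sk_eq ▸ (map_ne_zero S.Sk).2 hg.1)

theorem risingFactorial_toNat_ne_zero (hg : IsGamma S s t w g) :
    risingFactorial (ofPoly E (linForm s t w)) t.toNat ≠ 0 ∧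
      risingFactorial (ofPoly E (linForm s t w) + t) (-t).toNat ≠ 0 :=
  div_ne_zero_iff.1 (gammaQuotient_eq_div (K := E) _ t ▸ hg.gammaQuotient_Sk_ne_zero)

theorem risingFactorial_mul_Sk (hg : IsGamma S s t w g) :
    risingFactorial (ofPoly E (linForm s t w) + t) (-t).toNat * S.Sk g =
      risingFactorial (ofPoly E (linForm s t w)) t.toNat * g := by
  rw [hg.Sk_eq, gammaQuotient_eq_div, ← mul_assoc,
    mul_div_cancel₀ _ hg.risingFactorial_toNat_ne_zero.2]

theorem add_natCast (hg : IsGamma S s t w g) {n : ℕ}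
    (hn : risingFactorial (ofPoly E (linForm s t w)) n ≠ 0) :
    IsGamma S s t (w + (n : C[X])) (risingFactorial (ofPoly E (linForm s t w)) n * g) := by
  refine isGamma_iff.2 ⟨mul_ne_zero hn hg.1, ?_, ?_⟩
  · rw [map_mul, S.Sx_risingFactorial, hg.Sx_eq, linForm_add_natCast, map_add, map_natCast,
      ← mul_assoc, ← mul_assoc, gammaQuotient_add_natCast_mul hn hg.gammaQuotient_Sx_ne_zero]
  · rw [map_mul, S.Sk_risingFactorial, hg.Sk_eq, linForm_add_natCast, map_add, map_natCast,
      ← mul_assoc, ← mul_assoc, gammaQuotient_add_natCast_mul hn hg.gammaQuotient_Sk_ne_zero]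

theorem Sx_iterate_eq {s : ℕ} (hg : IsGamma S s t w g) (i : ℕ) :
    S.Sx^[i] g = risingFactorial (ofPoly E (linForm s t w)) (s * i) * g := by
  induction i with
  | zero => rw [Function.iterate_zero_apply, mul_zero, risingFactorial_zero, one_mul]
  | succ i ih =>
    rw [Function.iterate_succ_apply', ih, map_mul, S.Sx_risingFactorial, hg.Sx_eq,
      gammaQuotient_eq_div, Int.toNat_natCast, Int.toNat_neg_natCast, risingFactorial_zero,
      div_one, mul_add_one, add_comm (s * i), risingFactorial_add, Int.cast_natCast]
    ring

theorem risingFactorial_ne_zero {s : ℕ} (hg : IsGamma S s t w g) (i : ℕ) :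
    risingFactorial (ofPoly E (linForm s t w)) (s * i) ≠ 0 := by
  have hne : (S.Sx ^ i) g ≠ 0 := (map_ne_zero _).2 hg.1
  rw [RingHom.coe_pow, hg.Sx_iterate_eq] at hne
  exact left_ne_zero_of_mul hne

theorem Sx_iterate_inv_eq {s : ℕ} (hg : IsGamma S s t w g) {i r : ℕ} (hi : i ≤ r) :
    S.Sx^[i] g⁻¹ =
      risingFactorial (ofPoly E (linForm s t w) + (s * i : ℕ)) (s * (r - i)) *
        (risingFactorial (ofPoly E (linForm s t w)) (s * r) * g)⁻¹ := by
  have hsplit := risingFactorial_add (ofPoly E (linForm s t w)) (s * i) (s * (r - i))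
  rw [← mul_add, Nat.add_sub_cancel' hi] at hsplit
  have hr := hg.risingFactorial_ne_zero r
  rw [hsplit] at hr ⊢
  rw [← RingHom.coe_pow, map_inv₀, RingHom.coe_pow, hg.Sx_iterate_eq, mul_inv, mul_inv, mul_inv,
    mul_comm (risingFactorial _ (s * i))⁻¹ (risingFactorial _ (s * (r - i)))⁻¹, ← mul_assoc,
    ← mul_assoc, mul_inv_cancel₀ (right_ne_zero_of_mul hr), one_mul]

variable {n : Fin 3 → ℕ}

theorem exists_Sk_eq (hg : IsGamma S s t w g) (hz : linForm s t w ∈ degreeBox C n) :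
    ∃ Q ∈ degreeBox C (t.toNat • n), ∃ R ∈ degreeBox C ((-t).toNat • n), R ≠ 0 ∧
      ofPoly E (polyShift C 2 R) * S.Sk g = ofPoly E Q * g := by
  have hden := hg.risingFactorial_toNat_ne_zero.2
  rw [← S.Sk_risingFactorial, ← map_risingFactorial, map_ne_zero] at hden
  refine ⟨_, risingFactorial_mem_degreeBox hz t.toNat,
    _, risingFactorial_mem_degreeBox hz (-t).toNat, fun h => hden (by rw [h, map_zero]), ?_⟩
  rw [← S.Sk_ofPoly, map_risingFactorial, S.Sk_risingFactorial, map_risingFactorial,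
    hg.risingFactorial_mul_Sk]

theorem exists_Sk_inv_eq (hg : IsGamma S s t w g) (hz : linForm s t w ∈ degreeBox C n) :
    ∃ Q ∈ degreeBox C ((-t).toNat • n), ∃ R ∈ degreeBox C (t.toNat • n), R ≠ 0 ∧
      ofPoly E (polyShift C 2 R) * S.Sk g⁻¹ = ofPoly E Q * g⁻¹ := by
  have hnum := hg.risingFactorial_toNat_ne_zero.1
  have hshift : polyShift C 2 (linForm s t w + (-t : ℤ)) = linForm s t w := by
    rw [map_add, map_intCast, polyShift_two_linForm, Int.cast_neg, add_neg_cancel_right]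
  refine ⟨_, risingFactorial_mem_degreeBox (add_intCast_mem_degreeBox hz t) (-t).toNat,
    _, risingFactorial_mem_degreeBox (add_intCast_mem_degreeBox hz (-t)) t.toNat,
    fun h => hnum ?_, ?_⟩
  · rw [← hshift, ← map_risingFactorial, ← map_risingFactorial, h, map_zero, map_zero]
  · rw [map_risingFactorial, hshift, map_inv₀, map_risingFactorial, map_risingFactorial, map_add,
      map_intCast, ← div_eq_mul_inv, ← div_eq_mul_inv,
      div_eq_div_iff ((map_ne_zero _).2 hg.1) hg.1, hg.risingFactorial_mul_Sk]

end IsGamma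

end Terms

section ShiftBase

variable {C : Type*} [Field C] {E : Type*} [Field E] [Algebra (RatXYK C) E]

/-- `H₁` is a common denominator of `H, S_x(H), …, S_x^r(H)`: each `S_x^i(H)` with `i ≤ r` is a
polynomial of degrees at most `e i` times `H₁`, and `S_k(H₁) / H₁ = Q / S_k(R)` for polynomials `Q`
and `R` of degrees at most `n` and `n'`. Moving `S_k` onto the denominator makes `S_k(Y R H₁)`
a polynomial multiple of `H₁` for every polynomial `Y`. -/
structure IsShiftBase (S : ShiftExtension C E) (r : ℕ) (e : ℕ → Fin 3 → ℕ) (n n' : Fin 3 → ℕ)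
    (H H₁ : E) : Prop where
  ne_zero : H ≠ 0
  exists_Sx_iterate_eq : ∀ i ≤ r, ∃ P ∈ degreeBox C (e i), S.Sx^[i] H = ofPoly E P * H₁
  exists_Sk_eq : ∃ Q ∈ degreeBox C n, ∃ R ∈ degreeBox C n', R ≠ 0 ∧
    ofPoly E (polyShift C 2 R) * S.Sk H₁ = ofPoly E Q * H₁

namespace IsShiftBase

variable {S : ShiftExtension C E} {r : ℕ} {e e' : ℕ → Fin 3 → ℕ} {m n n' q q' : Fin 3 → ℕ}
  {G G₁ H H₁ : E}

theorem mono (hH : IsShiftBase S r e n n' H H₁) (he : ∀ i ≤ r, e i ≤ e' i) (hn : n ≤ q)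
    (hn' : n' ≤ q') : IsShiftBase S r e' q q' H H₁ where
  ne_zero := hH.ne_zero
  exists_Sx_iterate_eq i hi :=
    let ⟨P, hP, h⟩ := hH.exists_Sx_iterate_eq i hi
    ⟨P, degreeBox_mono (he i hi) hP, h⟩
  exists_Sk_eq :=
    let ⟨Q, hQ, R, hR, h⟩ := hH.exists_Sk_eq
    ⟨Q, degreeBox_mono hn hQ, R, degreeBox_mono hn' hR, h⟩

theorem mul (hG : IsShiftBase S r e n n' G G₁) (hH : IsShiftBase S r e' q q' H H₁) :
    IsShiftBase S r (e + e') (n + q) (n' + q') (G * H) (G₁ * H₁) where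
  ne_zero := mul_ne_zero hG.ne_zero hH.ne_zero
  exists_Sx_iterate_eq i hi := by
    obtain ⟨P, hP, hPG⟩ := hG.exists_Sx_iterate_eq i hi
    obtain ⟨P', hP', hPH⟩ := hH.exists_Sx_iterate_eq i hi
    refine ⟨P * P', mul_mem_degreeBox hP hP', ?_⟩
    rw [iterate_map_mul, hPG, hPH, map_mul, mul_mul_mul_comm]
  exists_Sk_eq := by
    obtain ⟨Q, hQ, R, hR, hR0, hG₁⟩ := hG.exists_Sk_eq
    obtain ⟨Q', hQ', R', hR', hR0', hH₁⟩ := hH.exists_Sk_eq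
    refine ⟨Q * Q', mul_mem_degreeBox hQ hQ', R * R', mul_mem_degreeBox hR hR',
      mul_ne_zero hR0 hR0', ?_⟩
    rw [map_mul, map_mul, map_mul, map_mul, mul_mul_mul_comm, hG₁, hH₁, mul_mul_mul_comm]

theorem of_ofPoly {p : PolyXYK C} (hp : p ≠ 0) (hm : p ∈ degreeBox C m) :
    IsShiftBase S r (fun _ => m) 0 0 (ofPoly E p) 1 where
  ne_zero := ofPoly_ne_zero hp
  exists_Sx_iterate_eq i _ := by
    have hmaps : Set.MapsTo (polyShift C 0) (degreeBox C m) (degreeBox C m) :=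
      fun _ => polyShift_mem_degreeBox 0
    refine ⟨(polyShift C 0)^[i] p, hmaps.iterate i hm, ?_⟩
    rw [mul_one]
    exact (Function.Semiconj.iterate_right (f := ofPoly E) (fun p => (S.Sx_ofPoly p).symm) i p).symm
  exists_Sk_eq := ⟨1, one_mem_degreeBox _, 1, one_mem_degreeBox _, one_ne_zero, by
    simp only [map_one]⟩

theorem one : IsShiftBase S r 0 0 0 1 1 := by
  have h : IsShiftBase S r 0 0 0 (ofPoly E 1) 1 := of_ofPoly one_ne_zero (one_mem_degreeBox 0)
  rwa [map_one] at h

theorem prod {ι : Type*} {s : Finset ι} {e : ι → ℕ → Fin 3 → ℕ} {n n' : ι → Fin 3 → ℕ}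
    {F F₁ : ι → E} (hF : ∀ j, IsShiftBase S r (e j) (n j) (n' j) (F j) (F₁ j)) :
    IsShiftBase S r (∑ j ∈ s, e j) (∑ j ∈ s, n j) (∑ j ∈ s, n' j)
      (∏ j ∈ s, F j) (∏ j ∈ s, F₁ j) := by
  classical
  induction s using Finset.induction_on with
  | empty => exact one
  | insert j s hj ih =>
    simp only [Finset.sum_insert hj, Finset.prod_insert hj]
    exact (hF j).mul ih

theorem of_isPowX {α : C[X]} {g : E} (hg : IsPowX S α g) :
    IsShiftBase S r (fun i => i • ![0, α.natDegree, 0]) 0 0 g g where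
  ne_zero := hg.1
  exists_Sx_iterate_eq i _ := by
    refine ⟨ofY C α ^ i, pow_mem_degreeBox (ofY_mem_degreeBox α) i, ?_⟩
    induction i with
    | zero => rw [Function.iterate_zero_apply, pow_zero, map_one, one_mul]
    | succ i ih =>
      rw [Function.iterate_succ_apply', ih (by omega), map_mul, S.Sx_ofPoly, map_pow,
        polyShift_ofY zero_ne_one, hg.2.1, pow_succ, map_mul, mul_assoc]
      rfl
  exists_Sk_eq := ⟨1, one_mem_degreeBox _, 1, one_mem_degreeBox _, one_ne_zero, by
    simp only [map_one, hg.2.2]⟩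

theorem of_isPowK {β : C[X]} {g : E} (hg : IsPowK S β g) :
    IsShiftBase S r 0 ![0, β.natDegree, 0] 0 g g where
  ne_zero := hg.1
  exists_Sx_iterate_eq i _ := ⟨1, one_mem_degreeBox _, by
    rw [Function.iterate_fixed hg.2.1, map_one, one_mul]⟩
  exists_Sk_eq := ⟨ofY C β, ofY_mem_degreeBox β, 1, one_mem_degreeBox _, one_ne_zero, by
    rw [map_one, map_one, one_mul, hg.2.2]; rfl⟩

section Gamma

variable {s : ℕ} {t : ℤ} {w : C[X]} {g : E}

theorem of_isGamma (hg : IsGamma S s t w g) :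
    IsShiftBase S r (fun i => (s * i) • linDegree (linForm s t w))
      (t.toNat • linDegree (linForm s t w)) ((-t).toNat • linDegree (linForm s t w)) g g where
  ne_zero := hg.1
  exists_Sx_iterate_eq i _ := by
    refine ⟨_, risingFactorial_mem_degreeBox (linForm_mem_degreeBox s t w) (s * i), ?_⟩
    rw [hg.Sx_iterate_eq, map_risingFactorial]
  exists_Sk_eq := hg.exists_Sk_eq (linForm_mem_degreeBox s t w)

theorem exists_of_isGamma_inv (hg : IsGamma S s t w g) (r : ℕ) :
    ∃ g', IsGamma S s t (w + ((s * r : ℕ) : C[X])) g' ∧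
      IsShiftBase S r (fun i => (s * (r - i)) • linDegree (linForm s t w))
        ((-t).toNat • linDegree (linForm s t w)) (t.toNat • linDegree (linForm s t w))
        g⁻¹ g'⁻¹ := by
  have hg' := hg.add_natCast (hg.risingFactorial_ne_zero r)
  have hz := linForm_mem_degreeBox s t w
  have hz' : linForm s t (w + ((s * r : ℕ) : C[X])) ∈ degreeBox C (linDegree (linForm s t w)) := by
    rw [linForm_add_natCast]
    exact_mod_cast add_intCast_mem_degreeBox hz (s * r : ℕ)
  refine ⟨_, hg', inv_ne_zero hg.1, fun i hi => ?_, hg'.exists_Sk_inv_eq hz'⟩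
  refine ⟨_, risingFactorial_mem_degreeBox (add_intCast_mem_degreeBox hz (s * i : ℕ)) _, ?_⟩
  rw [hg.Sx_iterate_inv_eq hi, map_risingFactorial, map_add, Int.cast_natCast, map_natCast]

end Gamma

end IsShiftBase

end ShiftBase

section Terms

variable {C : Type*} [Field C] {E : Type*} [Field E] [Algebra (RatXYK C) E]
  {S : ShiftExtension C E} {r : ℕ} {e : ℕ → Fin 3 → ℕ} {n n' : Fin 3 → ℕ} {H H₁ : E}

theorem IsShiftBase.exists_eq_ofPoly_mul (hH : IsShiftBase S r e n n' H H₁) :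
    ∃ P₀ : PolyXYK C, H = ofPoly E P₀ * H₁ ∧ H₁ ≠ 0 := by
  obtain ⟨P₀, -, hP₀ : H = _⟩ := hH.exists_Sx_iterate_eq 0 r.zero_le
  exact ⟨P₀, hP₀, right_ne_zero_of_mul (hP₀ ▸ hH.ne_zero)⟩

theorem IsShiftBase.isHypergeometric (hH : IsShiftBase S 1 e n n' H H₁) :
    IsHypergeometric S H := by
  obtain ⟨P₀, hP₀, hH₁⟩ := hH.exists_eq_ofPoly_mul
  obtain ⟨P₁, -, hP₁ : S.Sx H = _⟩ := hH.exists_Sx_iterate_eq 1 le_rfl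
  obtain ⟨Q, -, R, -, hR, hQR⟩ := hH.exists_Sk_eq
  have hR' := ofPoly_ne_zero (E := E) ((map_ne_zero_iff _ (polyShift C 2).injective).2 hR)
  refine ⟨hH.ne_zero, ?_, ?_⟩
  · obtain ⟨q, hq⟩ := exists_algebraMap_eq_ofPoly_div (E := E) P₁ P₀
    exact ⟨q, by rw [hq, hP₁, hP₀, mul_div_mul_right _ _ hH₁]⟩
  · obtain ⟨q, hq⟩ := exists_algebraMap_eq_ofPoly_div (E := E) (polyShift C 2 P₀ * Q)
      (polyShift C 2 R * P₀)
    refine ⟨q, ?_⟩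
    rw [hq, hP₀, map_mul, S.Sk_ofPoly, eq_div_of_mul_eq hR' ((mul_comm _ _).trans hQR), map_mul,
      map_mul, mul_div_assoc', div_div, ← mul_assoc, ← mul_assoc,
      mul_div_mul_right _ _ hH₁]

theorem IsShiftBase.isRationalUpToConstant (hH : IsShiftBase S r e n n' H H₁) {q : PolyXYK C}
    (hq : q ≠ 0) (hproper : IsProperHypergeometric S (ofPoly E q * H₁))
    (hfix : S.Sk (ofPoly E q * H₁) = ofPoly E q * H₁) : IsRationalUpToConstant S H := by
  obtain ⟨P₀, hP₀, -⟩ := hH.exists_eq_ofPoly_mul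
  obtain ⟨f, hf⟩ := exists_algebraMap_eq_ofPoly_div (E := E) P₀ q
  refine ⟨f, _, hproper, by rw [hfix, div_self hproper.1.1], ?_⟩
  rw [hf, ← mul_assoc, div_mul_cancel₀ _ (ofPoly_ne_zero hq), hP₀]

end Terms

section Operators

variable {C : Type*} [Field C] {n : ℕ} {c : Fin n → PolyXY C}

/-- The operator `∑ cᵢ S_x^i` with a given list of coefficients, as provided by a solution of the
linear system. -/
def Operator.ofCoeffs (c : Fin n → PolyXY C) : Operator C :=
  ∑ i : Fin n, SkewPolynomial.monomial (i : ℕ) (c i)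

namespace Operator

theorem coeff_ofCoeffs (m : ℕ) :
    SkewPolynomial.coeff (ofCoeffs c) m = ∑ i : Fin n, if (i : ℕ) = m then c i else 0 := by
  let φ : Operator C →+ PolyXY C :=
    (Finsupp.applyAddHom (Multiplicative.ofAdd m)).comp
      SkewMonoidAlgebra.coeffAddEquiv.toAddMonoidHom
  calc φ (ofCoeffs c) = ∑ i : Fin n, φ (SkewPolynomial.monomial (i : ℕ) (c i)) := map_sum _ _ _
    _ = _ := Finset.sum_congr rfl fun i _ => SkewPolynomial.coeff_monomial

theorem coeff_ofCoeffs_val (i : Fin n) : SkewPolynomial.coeff (ofCoeffs c) i = c i := by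
  simp only [coeff_ofCoeffs, Fin.val_inj, Finset.sum_ite_eq', Finset.mem_univ, if_true]

theorem support_ofCoeffs_subset :
    SkewPolynomial.support (ofCoeffs c) ⊆ Finset.univ.image (Fin.val : Fin n → ℕ) := by
  intro m hm
  rw [SkewPolynomial.mem_support_iff, coeff_ofCoeffs] at hm
  obtain ⟨i, hi, him⟩ := Finset.exists_ne_zero_of_sum_ne_zero hm
  exact Finset.mem_image.2 ⟨i, hi, by_contra fun h => him (if_neg h)⟩

theorem sup_support_ofCoeffs_le {f : ℕ → ℕ} {b : ℕ} (hf : ∀ i : Fin n, f i ≤ b) :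
    (SkewPolynomial.support (ofCoeffs c)).sup f ≤ b := by
  refine Finset.sup_le fun m hm => ?_
  obtain ⟨i, -, rfl⟩ := Finset.mem_image.1 (support_ofCoeffs_subset hm)
  exact hf i

theorem ofCoeffs_ne_zero (hc : c ≠ 0) : ofCoeffs c ≠ 0 := by
  obtain ⟨i, hi⟩ := Function.ne_iff.1 hc
  intro h
  have hcoeff := coeff_ofCoeffs_val (c := c) i
  rw [h, SkewPolynomial.coeff_zero] at hcoeff
  exact hi hcoeff.symm

theorem apply_ofCoeffs {E : Type*} [Field E] [Algebra (RatXYK C) E] (S : ShiftExtension C E)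
    (H : E) : apply S (ofCoeffs c) H = ∑ i : Fin n, ofPoly E (polyOfXY C (c i)) * S.Sx^[i] H := by
  rw [apply, Finset.sum_subset support_ofCoeffs_subset,
    Finset.sum_image Fin.val_injective.injOn]
  · simp only [coeff_ofCoeffs_val]
    rfl
  · intro m _ hm
    rw [SkewPolynomial.mem_support_iff, not_not] at hm
    rw [hm, map_zero, map_zero, zero_mul]

end Operator

end Operators

section Telescopers

variable {C : Type*} [Field C] {E : Type*} [Field E] [Algebra (RatXYK C) E]
  {S : ShiftExtension C E} {H H₁ : E}

theorem isTelescoper_of_telescopingMap_eq_zero {m : ℕ} {c : Fin m → PolyXY C} (hc : c ≠ 0)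
    {P : Fin m → PolyXYK C} {P₀ Q R Y : PolyXYK C}
    (hP : ∀ i : Fin m, S.Sx^[i] H = ofPoly E (P i) * H₁) (hP₀ : H = ofPoly E P₀ * H₁) (hH : H ≠ 0)
    (hQR : ofPoly E (polyShift C 2 R) * S.Sk H₁ = ofPoly E Q * H₁)
    (hcY : telescopingMap P Q R (c, Y) = 0) : IsTelescoper S H (Operator.ofCoeffs c) := by
  have hP₀' : ofPoly E P₀ ≠ 0 := left_ne_zero_of_mul (hP₀ ▸ hH)
  obtain ⟨g, hg⟩ := exists_algebraMap_eq_ofPoly_div (E := E) (Y * R) P₀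
  have hgH : algebraMap (RatXYK C) E g * H = ofPoly E (Y * R) * H₁ := by
    rw [hg, hP₀, ← mul_assoc, div_mul_cancel₀ _ hP₀']
  refine ⟨Operator.ofCoeffs_ne_zero hc, g, ?_⟩
  calc Operator.apply S (Operator.ofCoeffs c) H
      = ofPoly E (∑ i, polyOfXY C (c i) * P i) * H₁ := by
        simp only [Operator.apply_ofCoeffs, hP, map_sum, map_mul, Finset.sum_mul, mul_assoc]
    _ = ofPoly E (Q * polyShift C 2 Y - R * Y) * H₁ := by rw [sub_eq_zero.1 hcY]
    _ = S.Sk (algebraMap (RatXYK C) E g * H) - algebraMap (RatXYK C) E g * H := by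
        rw [hgH, map_mul S.Sk, S.Sk_ofPoly]
        simp only [map_mul, map_sub]
        linear_combination -ofPoly E (polyShift C 2 Y) * hQR

theorem IsShiftBase.exists_isTelescoper {r d h : ℕ} {e : ℕ → Fin 3 → ℕ} {n y : Fin 3 → ℕ}
    (hH : IsShiftBase S r e n n H H₁)
    (hconst : ∀ q : PolyXYK C, q ≠ 0 → S.Sk (ofPoly E q * H₁) ≠ ofPoly E q * H₁)
    (he : ∀ i ≤ r, ![d, h, 0] + e i ≤ n + y)
    (hcard : ∏ j, (n j + y j + 1) < (r + 1) * (d + 1) * (h + 1) + ∏ j, (y j + 1)) :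
    ∃ L : Operator C, IsTelescoper S H L ∧ L.order ≤ r ∧ L.degree ≤ d ∧ L.height ≤ h := by
  choose P hP hPH using fun i : Fin (r + 1) => hH.exists_Sx_iterate_eq i i.is_le
  obtain ⟨Q, hQ, R, hR, hR0, hQR⟩ := hH.exists_Sk_eq
  obtain ⟨c, Y, hcY0, hc, hcY⟩ := exists_telescopingMap_eq_zero (m := ![d, h]) hP hQ hR
    (fun i => he i i.is_le) (by simpa [mul_assoc] using hcard)
  have hc0 : c ≠ 0 := by
    rintro rfl
    have hY : Y ≠ 0 := fun hY => hcY0 (by rw [hY]; rfl)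
    have hfix : R * Y = Q * polyShift C 2 Y := by
      simpa [telescopingMap, sub_eq_zero] using hcY
    refine hconst (R * Y) (mul_ne_zero hR0 hY) ?_
    rw [map_mul S.Sk, S.Sk_ofPoly, map_mul, map_mul, mul_right_comm, hQR, mul_right_comm, ← map_mul,
      hfix]
  refine ⟨_, isTelescoper_of_telescopingMap_eq_zero hc0 hPH (hPH 0) hH.ne_zero hQR hcY,
    Operator.sup_support_ofCoeffs_le fun i => i.is_le,
    Operator.sup_support_ofCoeffs_le fun i => ?_, Operator.sup_support_ofCoeffs_le fun i => ?_⟩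
  all_goals rw [Operator.coeff_ofCoeffs_val]
  exacts [mem_degreeBox.1 (hc i) 0, mem_degreeBox.1 (hc i) 1]

end Telescopers

namespace ProperForm

section Degrees

variable {C : Type*} [Field C] (D : ProperForm C)

/-- `(ϑ_x, ϑ_y, ϑ_k)`, the degrees of `p`. -/
def theta : Fin 3 → ℕ := ![D.thetaX, D.thetaY, D.thetaK]

/-- `(μ, ξ, μ)`, the bounds on the degrees in `x`, `y` and `k` by which one application of `S_x`
enlarges the numerators of the shift quotients. -/
def boundSx : Fin 3 → ℕ := ![D.mu, D.xi, D.mu]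

/-- `(ν, η, ν)`, the bounds on the degrees in `x`, `y` and `k` of the numerator and the denominator
of the quotient by `S_k`. -/
def boundSk : Fin 3 → ℕ := ![D.nu, D.eta, D.nu]

theorem p_mem_degreeBox : D.p ∈ degreeBox C D.theta :=
  mem_degreeBox.2 fun j => by fin_cases j <;> exact le_rfl

theorem sum_le_boundSx_of_numerator :
    ![0, D.α.natDegree, 0] +
      ∑ m, (D.a m • linDegree (D.A m) + D.b m • linDegree (D.B m)) ≤ D.boundSx := by
  intro j
  fin_cases j <;> simp [linDegree, boundSx, mu, xi]

theorem sum_le_boundSx_of_denominator :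
    ∑ m, (D.u m • linDegree (D.U m) + D.v m • linDegree (D.V m)) ≤ D.boundSx := by
  intro j
  fin_cases j <;> simp [linDegree, boundSx, mu, xi]

theorem sum_le_boundSk_of_numerator :
    ![0, D.β.natDegree, 0] +
      ∑ m, (D.a1 m • linDegree (D.A m) + D.v1 m • linDegree (D.V m)) ≤ D.boundSk := by
  intro j
  fin_cases j <;> simp [linDegree, boundSk, nu, eta]

theorem sum_le_boundSk_of_denominator :
    ∑ m, (D.u1 m • linDegree (D.U m) + D.b1 m • linDegree (D.B m)) ≤ D.boundSk := by
  intro j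
  fin_cases j <;> simp [linDegree, boundSk, nu, eta]

end Degrees

namespace IsFormOf

variable {C : Type*} [Field C] {E : Type*} [Field E] [Algebra (RatXYK C) E]
  {S : ShiftExtension C E} {D : ProperForm C} {H : E}

theorem exists_isShiftBase (hH : D.IsFormOf S H) (r : ℕ) :
    ∃ H₁ : E, (∀ q : PolyXYK C, q ≠ 0 → ∃ D' : ProperForm C, D'.IsFormOf S (ofPoly E q * H₁)) ∧
      IsShiftBase S r (fun _ => D.theta + r • D.boundSx) D.boundSk D.boundSk H H₁ := by
  obtain ⟨ex, ek, gA, gB, gU, gV, hex, hek, hA, hB, hU, hV, rfl⟩ := hH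
  choose gU' hgU' hU' using fun m => IsShiftBase.exists_of_isGamma_inv (hU m) r
  choose gV' hgV' hV' using fun m => IsShiftBase.exists_of_isGamma_inv (hV m) r
  refine ⟨ex * ek * ∏ m, (gA m * gB m) / (gU' m * gV' m), fun q hq => ?_, ?_⟩
  · refine ⟨{ D with
      p := q
      p_ne_zero := hq
      u2 := fun m => D.u2 m + ((D.u m * r : ℕ) : C[X])
      v2 := fun m => D.v2 m + ((D.v m * r : ℕ) : C[X]) },
      ex, ek, gA, gB, gU', gV', hex, hek, hA, hB, hgU', hgV', ?_⟩
    simp only [mul_assoc]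
    rfl
  have hprod := IsShiftBase.prod (s := Finset.univ) fun m =>
    ((IsShiftBase.of_isGamma (r := r) (hA m)).mul (.of_isGamma (hB m))).mul ((hU' m).mul (hV' m))
  have hform := (((IsShiftBase.of_ofPoly D.p_ne_zero D.p_mem_degreeBox).mul (.of_isPowX hex)).mul
    (.of_isPowK hek)).mul hprod
  rw [one_mul] at hform
  simp only [div_eq_mul_inv, mul_inv]
  refine hform.mono (fun i hi => ?_) ?_ ?_
  · calc _ = D.theta + (i • (![0, D.α.natDegree, 0] +
            ∑ m, (D.a m • linDegree (D.A m) + D.b m • linDegree (D.B m))) +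
          (r - i) • ∑ m, (D.u m • linDegree (D.U m) + D.v m • linDegree (D.V m))) := by
          simp only [Pi.add_apply, Finset.sum_apply, add_zero, smul_add,
            Finset.smul_sum, smul_smul, Finset.sum_add_distrib, A, B, U, V, add_assoc, mul_comm]
      _ ≤ D.theta + (i • D.boundSx + (r - i) • D.boundSx) := by
          gcongr
          exacts [D.sum_le_boundSx_of_numerator, D.sum_le_boundSx_of_denominator]
      _ = D.theta + r • D.boundSx := by rw [← add_smul, Nat.add_sub_cancel' hi]
  · refine le_of_eq_of_le ?_ D.sum_le_boundSk_of_numerator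
    simp [A, V]
  · refine le_of_eq_of_le ?_ D.sum_le_boundSk_of_denominator
    simp [B, U, add_comm]

theorem isHypergeometric (hH : D.IsFormOf S H) : IsHypergeometric S H :=
  have ⟨_, _, hbase⟩ := hH.exists_isShiftBase 1
  hbase.isHypergeometric

end IsFormOf

end ProperForm

end Telescoping

end

theorem theorem2_general {C : Type*} [Field C]
    {E : Type*} [Field E] [Algebra (Telescoping.RatXYK C) E]
    (S : Telescoping.ShiftExtension C E)
    (D : Telescoping.ProperForm C) (H : E) (hH : D.IsFormOf S H)
    (hrat : ¬ Telescoping.IsRationalUpToConstant S H)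
    (r d h : ℕ)
    (hx : 0 ≤ (d : ℤ) + D.thetaX + r * D.mu - D.nu)
    (hy : 0 ≤ (h : ℤ) + D.thetaY + r * D.xi - D.eta)
    (hk : 0 ≤ (D.thetaK : ℤ) + r * D.mu - D.nu)
    (hineq : 0 < ((r : ℤ) + 1) * (d + 1) * (h + 1)
      - ((d : ℤ) + 1 + D.thetaX + r * D.mu) * (D.thetaK + r * D.mu + 1) * D.eta
      - ((d : ℤ) + 2 + D.thetaX + D.thetaK + 2 * r * D.mu - D.nu)
        * (h + 1 + D.thetaY + r * D.xi - D.eta) * D.nu) :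
    ∃ L : Telescoping.Operator C, Telescoping.IsTelescoper S H L ∧
      Telescoping.Operator.order L ≤ r ∧ Telescoping.Operator.degree L ≤ d ∧
      Telescoping.Operator.height L ≤ h := by
  obtain ⟨H₁, hforms, hbase⟩ := hH.exists_isShiftBase r
  have hconst (q : Telescoping.PolyXYK C) (hq : q ≠ 0) :
      S.Sk (Telescoping.ofPoly E q * H₁) ≠ Telescoping.ofPoly E q * H₁ := fun hfix =>
    have ⟨D', hD'⟩ := hforms q hq
    hrat (hbase.isRationalUpToConstant hq ⟨hD'.isHypergeometric, D', hD'⟩ hfix)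
  obtain ⟨y₀, hy₀⟩ := Int.eq_ofNat_of_zero_le hx
  obtain ⟨y₁, hy₁⟩ := Int.eq_ofNat_of_zero_le hy
  obtain ⟨y₂, hy₂⟩ := Int.eq_ofNat_of_zero_le hk
  have hdeg : ![d, h, 0] + (D.theta + r • D.boundSx) = D.boundSk + ![y₀, y₁, y₂] := by
    ext j
    zify
    fin_cases j <;> simp [Telescoping.ProperForm.theta, Telescoping.ProperForm.boundSx,
      Telescoping.ProperForm.boundSk] <;> linarith
  refine hbase.exists_isTelescoper hconst (fun _ _ => hdeg.le) ?_
  zify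
  simp only [Fin.prod_univ_three, Telescoping.ProperForm.boundSk, Matrix.cons_val]
  rw [← hy₀, ← hy₁, ← hy₂]
  linarith

theorem theorem2 {C : Type*} [Field C] [CharZero C]
    {E : Type*} [Field E] [Algebra (Telescoping.RatXYK C) E]
    (S : Telescoping.ShiftExtension C E)
    (D : Telescoping.ProperForm C) (H : E) (hH : D.IsFormOf S H)
    (hrat : ¬ Telescoping.IsRationalUpToConstant S H)
    (r d h : ℕ)
    (hx : 0 ≤ (d : ℤ) + D.thetaX + r * D.mu - D.nu)
    (hy : 0 ≤ (h : ℤ) + D.thetaY + r * D.xi - D.eta)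
    (hk : 0 ≤ (D.thetaK : ℤ) + r * D.mu - D.nu)
    (hineq : 0 < ((r : ℤ) + 1) * (d + 1) * (h + 1)
      - ((d : ℤ) + 1 + D.thetaX + r * D.mu) * (D.thetaK + r * D.mu + 1) * D.eta
      - ((d : ℤ) + 2 + D.thetaX + D.thetaK + 2 * r * D.mu - D.nu)
        * (h + 1 + D.thetaY + r * D.xi - D.eta) * D.nu) :
    ∃ L : Telescoping.Operator C, Telescoping.IsTelescoper S H L ∧
      Telescoping.Operator.order L ≤ r ∧ Telescoping.Operator.degree L ≤ d ∧
      Telescoping.Operator.height L ≤ h :=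
  theorem2_general S D H hH hrat r d h hx hy hk hineq
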